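/- **Strong normalization of the Calculus of Constructions.** *Expressions* are generated by the grammar $$A, B, a, b ::= s \mid x \mid (x : A) \to B \mid \lambda x : A.\, b \mid a\, b,$$ where $s \in \{\ast, \Box\}$ is a sort and $x$ a variable; $x$ is bound in $B$ and in $b$, respectively (not in $A$), and expressions are identified up to renaming of bound variables. A *context* $\Gamma$ is a finite list $x_1 : A_1, \dots, x_n : A_n$. One-step *$\beta$-reduction* $\leadsto$ is the closure of $(\lambda x : A.\, b)\, a \leadsto [a/x]b$ (capture-avoiding substitution) under all expression formers: a step may take place in either immediate subexpression of $(x : A) \to B$, of $\lambda x : A.\, b$ and of $a\, b$. *$\beta$-conversion* $=_\beta$ is the reflexive, symmetric and transitive closure of $\leadsto$. The judgements $\vdash \Gamma$ (well-formed context) and $\Gamma \vdash a : A$ (typing) of the Calculus of Constructions are defined by simultaneous induction, by the following rules, where $$\mathcal R = \{(\ast,\ast,\ast),\ (\Box,\ast,\ast),\ (\Box,\Box,\Box),\ (\ast,\Box,\Box)\}.$$ - $\vdash \cdot$ for the empty context; if $x$ is not declared in $\Gamma$ and $\Gamma \vdash A : s$ for a sort $s$, then $\vdash \Gamma, x : A$.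 - If $\vdash \Gamma$, then $\Gamma \vdash \ast : \Box$. - If $\vdash \Gamma$ and $(x : A) \in \Gamma$, then $\Gamma \vdash x : A$. - If $\Gamma \vdash A : s_1$, $\ \Gamma, x : A \vdash B : s_2$ and $(s_1, s_2, s_3) \in \mathcal R$, then $\Gamma \vdash (x : A) \to B : s_3$. - If $\Gamma \vdash (x : A) \to B : s$ for a sort $s$ and $\Gamma, x : A \vdash b : B$, then $\Gamma \vdash \lambda x : A.\, b : (x : A) \to B$. - If $\Gamma \vdash a : (x : A) \to B$ and $\Gamma \vdash b : A$, then $\Gamma \vdash a\, b : [b/x]B$. - If $\Gamma \vdash a : A$, $\ \Gamma \vdash B : s$ for a sort $s$, and $A =_\beta B$, then $\Gamma \vdash a : B$. An expression $a$ is *strongly normalizing*, written $a \in \mathsf{SN}$, if there is no infinite reduction sequence $a = a_0 \leadsto a_1 \leadsto a_2 \leadsto \cdots$. **Theorem.** For every context $\Gamma$ and all expressions $a, A$: if $\Gamma \vdash a : A$ in the Calculus of Constructions, then $a \in \mathsf{SN}$. -/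

import Mathlib

namespace CoC

/-- A specification of a pure type system with sorts `S`: the axioms `(s₁, s₂)` and the
rules `(s₁, s₂, s₃)` for forming product types. -/
structure PTS (S : Type) where
  axioms : Set (S × S)
  rules : Set (S × S × S)

/-- Expressions over the sorts `S`, up to renaming of bound variables: variables are de Bruijn
indices, and `pi A B`, `lam A b` bind the index `0` in `B`, `b` (but not in `A`). -/
inductive Exp (S : Type) : Type where
  | sort (s : S)
  | var (x : ℕ)
  | pi (A B : Exp S)
  | lam (A b : Exp S)
  | app (a b : Exp S)

namespace Exp

variable {S : Type}

/-- The renaming `r` under one binder. -/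
def upRen (r : ℕ → ℕ) : ℕ → ℕ
  | 0 => 0
  | x + 1 => r x + 1

/-- Simultaneous renaming of the free variables. -/
def rename : (ℕ → ℕ) → Exp S → Exp S
  | _, sort s => sort s
  | r, var x => var (r x)
  | r, pi A B => pi (rename r A) (rename (upRen r) B)
  | r, lam A b => lam (rename r A) (rename (upRen r) b)
  | r, app a b => app (rename r a) (rename r b)

/-- Weakening by one fresh variable, which receives the index `0`. -/
def shift (a : Exp S) : Exp S := rename Nat.succ a

/-- The substitution `t` under one binder. -/
def upSubst (t : ℕ → Exp S) : ℕ → Exp S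
  | 0 => var 0
  | x + 1 => shift (t x)

/-- Simultaneous capture-avoiding substitution for the free variables. -/
def subst : (ℕ → Exp S) → Exp S → Exp S
  | _, sort s => sort s
  | t, var x => t x
  | t, pi A B => pi (subst t A) (subst (upSubst t) B)
  | t, lam A b => lam (subst t A) (subst (upSubst t) b)
  | t, app a b => app (subst t a) (subst t b)

/-- The substitution sending the index `0` to `a` and lowering the other variables by one. -/
def single (a : Exp S) : ℕ → Exp S
  | 0 => a
  | x + 1 => var x

/-- `inst b a` is `[a/x]b`, where `x` is the variable with index `0` in `b`. -/
def inst (b a : Exp S) : Exp S := subst (single a) b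

end Exp

open Exp in
/-- One-step `β`-reduction, in any position of an expression. -/
inductive Step {S : Type} : Exp S → Exp S → Prop where
  | beta (A b a : Exp S) : Step (app (lam A b) a) (inst b a)
  | pi₁ {A A₁ : Exp S} (B : Exp S) : Step A A₁ → Step (pi A B) (pi A₁ B)
  | pi₂ (A : Exp S) {B B₁ : Exp S} : Step B B₁ → Step (pi A B) (pi A B₁)
  | lam₁ {A A₁ : Exp S} (b : Exp S) : Step A A₁ → Step (lam A b) (lam A₁ b)
  | lam₂ (A : Exp S) {b b₁ : Exp S} : Step b b₁ → Step (lam A b) (lam A b₁)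
  | app₁ {a a₁ : Exp S} (b : Exp S) : Step a a₁ → Step (app a b) (app a₁ b)
  | app₂ (a : Exp S) {b b₁ : Exp S} : Step b b₁ → Step (app a b) (app a b₁)

/-- `β`-conversion: the reflexive, symmetric and transitive closure of one-step reduction. -/
def Conv {S : Type} : Exp S → Exp S → Prop := Relation.EqvGen Step

/-- The strongly normalizing expressions: those from which no infinite reduction sequence
starts. -/
def SN {S : Type} : Set (Exp S) :=
  {a | ¬ ∃ f : ℕ → Exp S, f 0 = a ∧ ∀ n, Step (f n) (f (n + 1))}

/-- Contexts, with the most recently added variable (the index `0`) at the head. The type of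
each variable lives over the rest of the list behind it. -/
abbrev Ctx (S : Type) : Type := List (Exp S)

/-- `Lookup Γ x A` means that `x : A` is in `Γ`, with `A` weakened to an expression over the
whole of `Γ`. -/
inductive Lookup {S : Type} : Ctx S → ℕ → Exp S → Prop where
  | zero (Γ : Ctx S) (A : Exp S) : Lookup (A :: Γ) 0 (Exp.shift A)
  | succ {Γ : Ctx S} {x : ℕ} {A : Exp S} (B : Exp S) :
      Lookup Γ x A → Lookup (B :: Γ) (x + 1) (Exp.shift A)

open Exp in
mutual

/-- `WF P Γ` is the judgement `⊢ Γ` of the pure type system `P`. -/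
inductive WF {S : Type} (P : PTS S) : Ctx S → Prop where
  | nil : WF P []
  | cons {Γ : Ctx S} {A : Exp S} {s : S} : Typing P Γ A (sort s) → WF P (A :: Γ)

/-- `Typing P Γ a A` is the judgement `Γ ⊢ a : A` of the pure type system `P`. -/
inductive Typing {S : Type} (P : PTS S) : Ctx S → Exp S → Exp S → Prop where
  | sort {Γ : Ctx S} {s₁ s₂ : S} :
      WF P Γ → (s₁, s₂) ∈ P.axioms → Typing P Γ (sort s₁) (sort s₂)
  | var {Γ : Ctx S} {x : ℕ} {A : Exp S} :
      WF P Γ → Lookup Γ x A → Typing P Γ (var x) A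
  | pi {Γ : Ctx S} {A B : Exp S} {s₁ s₂ s₃ : S} :
      Typing P Γ A (sort s₁) → Typing P (A :: Γ) B (sort s₂) → (s₁, s₂, s₃) ∈ P.rules →
      Typing P Γ (pi A B) (sort s₃)
  | lam {Γ : Ctx S} {A B b : Exp S} {s : S} :
      Typing P Γ (pi A B) (sort s) → Typing P (A :: Γ) b B → Typing P Γ (lam A b) (pi A B)
  | app {Γ : Ctx S} {A B a b : Exp S} :
      Typing P Γ a (pi A B) → Typing P Γ b A → Typing P Γ (app a b) (inst B b)
  | conv {Γ : Ctx S} {A B a : Exp S} {s : S} :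
      Typing P Γ a A → Typing P Γ B (sort s) → Conv A B → Typing P Γ a B

end

/-- The sorts of the calculus of constructions. -/
inductive CCSort : Type where
  | star
  | box

open CCSort in
/-- The calculus of constructions as a pure type system. -/
def CC : PTS CCSort where
  axioms := {(star, box)}
  rules := {(star, star, star), (box, star, star), (box, box, box), (star, box, box)}

end CoC

-- The method is Girard's. Every type denotes a candidate: a set of strongly normalizing
-- expressions, closed under reduction, that contains each non-abstraction whose one-step reducts it
-- contains. A typed expression, once realizers are substituted for its variables, lies in the
-- candidate of its type (`Typing.realizes`). Variables lie in every candidate, so the identity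
-- substitution gives the theorem.
--
-- Type constructors need denotations as well, namely functions over candidates, although types may
-- depend on objects. That dependence is discarded: a kind leaves behind a simple skeleton, which
-- fixes a semantic domain `Dom`, and a constructor that expects an object denotes what its body
-- denotes. Sorts and kinds denote candidates too, so one statement covers objects, constructors and
-- kinds.
--
-- Skeletons come from a classification `cls` of raw expressions. Reduction preserves an existing
-- class (`Step.cls_eq`) and the interpretation of a classified expression (`Step.interp_eq`), both
-- by substitution lemmas. No typing enters here, so subject reduction is not needed; Church-Rosser
-- extends both facts to conversion.
--
-- A product over a kind intersects over all semantic values of its argument, independently of the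
-- argument itself. The set of candidates is fixed beforehand, so impredicativity causes no
-- circularity.

namespace CoC

-- Renaming and substitution

namespace Exp

variable {S : Type}

/-- Extension of a sequence by a new first entry. -/
def scons {α : Sort*} (v : α) (r : ℕ → α) : ℕ → α
  | 0 => v
  | x + 1 => r x

theorem upRen_comp (r q : ℕ → ℕ) : upRen r ∘ upRen q = upRen (r ∘ q) := by
  funext x; cases x <;> rfl

theorem upSubst_comp_upRen (t : ℕ → Exp S) (r : ℕ → ℕ) :
    upSubst t ∘ upRen r = upSubst (t ∘ r) := by
  funext x; cases x <;> rfl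

theorem rename_rename (a : Exp S) (r q : ℕ → ℕ) :
    rename r (rename q a) = rename (r ∘ q) a := by
  induction a generalizing r q with
  | sort s => rfl
  | var x => rfl
  | pi A B ihA ihB => simp only [rename, ihA, ihB, upRen_comp]
  | lam A b ihA ihb => simp only [rename, ihA, ihb, upRen_comp]
  | app a b iha ihb => simp only [rename, iha, ihb]

theorem subst_rename (a : Exp S) (t : ℕ → Exp S) (r : ℕ → ℕ) :
    subst t (rename r a) = subst (t ∘ r) a := by
  induction a generalizing t r with
  | sort s => rfl
  | var x => rfl
  | pi A B ihA ihB => simp only [rename, subst, ihA, ihB, upSubst_comp_upRen]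
  | lam A b ihA ihb => simp only [rename, subst, ihA, ihb, upSubst_comp_upRen]
  | app a b iha ihb => simp only [rename, subst, iha, ihb]

theorem rename_upRen_comp_upSubst (t : ℕ → Exp S) (r : ℕ → ℕ) :
    rename (upRen r) ∘ upSubst t = upSubst (rename r ∘ t) := by
  funext x
  cases x with
  | zero => rfl
  | succ x => simp only [Function.comp, upSubst, shift, rename_rename]; rfl

theorem rename_subst (a : Exp S) (t : ℕ → Exp S) (r : ℕ → ℕ) :
    rename r (subst t a) = subst (rename r ∘ t) a := by
  induction a generalizing t r with
  | sort s => rfl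
  | var x => rfl
  | pi A B ihA ihB => simp only [rename, subst, ihA, ihB, rename_upRen_comp_upSubst]
  | lam A b ihA ihb => simp only [rename, subst, ihA, ihb, rename_upRen_comp_upSubst]
  | app a b iha ihb => simp only [rename, subst, iha, ihb]

theorem subst_upSubst_comp_upSubst (t u : ℕ → Exp S) :
    subst (upSubst t) ∘ upSubst u = upSubst (subst t ∘ u) := by
  funext x
  cases x with
  | zero => rfl
  | succ x => simp only [Function.comp, upSubst, shift, subst_rename, rename_subst]; rfl

theorem subst_subst (a : Exp S) (t u : ℕ → Exp S) :
    subst t (subst u a) = subst (subst t ∘ u) a := by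
  induction a generalizing t u with
  | sort s => rfl
  | var x => rfl
  | pi A B ihA ihB => simp only [subst, ihA, ihB, subst_upSubst_comp_upSubst]
  | lam A b ihA ihb => simp only [subst, ihA, ihb, subst_upSubst_comp_upSubst]
  | app a b iha ihb => simp only [subst, iha, ihb]

theorem upSubst_var : upSubst (var : ℕ → Exp S) = var := by
  funext x; cases x <;> rfl

theorem subst_var (a : Exp S) : subst var a = a := by
  induction a with
  | sort s => rfl
  | var x => rfl
  | pi A B ihA ihB => simp only [subst, upSubst_var, ihA, ihB]
  | lam A b ihA ihb => simp only [subst, upSubst_var, ihA, ihb]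
  | app a b iha ihb => simp only [subst, iha, ihb]

/-- Links the contractum of a substituted abstraction with the extended substitution under which its
body is interpreted. -/
theorem inst_subst_upSubst (b a : Exp S) (t : ℕ → Exp S) :
    inst (subst (upSubst t) b) a = subst (scons a t) b := by
  rw [inst, subst_subst]
  congr 1
  funext x
  cases x with
  | zero => rfl
  | succ x =>
    simp only [Function.comp, upSubst, shift, subst_rename, scons]
    exact subst_var _

theorem subst_inst (b a : Exp S) (t : ℕ → Exp S) :
    subst t (inst b a) = inst (subst (upSubst t) b) (subst t a) := by
  rw [inst_subst_upSubst, inst, subst_subst]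
  congr 1
  funext x
  cases x <;> rfl

theorem rename_inst (b a : Exp S) (r : ℕ → ℕ) :
    rename r (inst b a) = inst (rename (upRen r) b) (rename r a) := by
  rw [inst, inst, rename_subst, subst_rename]
  congr 1
  funext x
  cases x <;> rfl

end Exp

open Exp Relation

variable {S : Type}

-- Reduction and substitution

namespace Step

theorem subst {a b : Exp S} (h : Step a b) (t : ℕ → Exp S) : Step (a.subst t) (b.subst t) := by
  induction h generalizing t with
  | beta A b a => rw [subst_inst]; exact .beta _ _ _
  | pi₁ B _ ih => exact .pi₁ _ (ih t)
  | pi₂ A _ ih => exact .pi₂ _ (ih _)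
  | lam₁ b _ ih => exact .lam₁ _ (ih t)
  | lam₂ A _ ih => exact .lam₂ _ (ih _)
  | app₁ b _ ih => exact .app₁ _ (ih t)
  | app₂ a _ ih => exact .app₂ _ (ih t)

theorem rename {a b : Exp S} (h : Step a b) (r : ℕ → ℕ) : Step (a.rename r) (b.rename r) := by
  induction h generalizing r with
  | beta A b a => rw [rename_inst]; exact .beta _ _ _
  | pi₁ B _ ih => exact .pi₁ _ (ih r)
  | pi₂ A _ ih => exact .pi₂ _ (ih _)
  | lam₁ b _ ih => exact .lam₁ _ (ih r)
  | lam₂ A _ ih => exact .lam₂ _ (ih _)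
  | app₁ b _ ih => exact .app₁ _ (ih r)
  | app₂ a _ ih => exact .app₂ _ (ih r)

end Step

/-- Many-step `β`-reduction. -/
abbrev Steps : Exp S → Exp S → Prop := ReflTransGen Step

namespace Steps

theorem pi {A A' B B' : Exp S} (hA : Steps A A') (hB : Steps B B') :
    Steps (.pi A B) (.pi A' B') :=
  (hA.lift (Exp.pi · B) fun _ _ => .pi₁ B).trans (hB.lift (Exp.pi A') fun _ _ => .pi₂ A')

theorem lam {A A' b b' : Exp S} (hA : Steps A A') (hb : Steps b b') :
    Steps (.lam A b) (.lam A' b') :=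
  (hA.lift (Exp.lam · b) fun _ _ => .lam₁ b).trans (hb.lift (Exp.lam A') fun _ _ => .lam₂ A')

theorem app {a a' b b' : Exp S} (ha : Steps a a') (hb : Steps b b') :
    Steps (.app a b) (.app a' b') :=
  (ha.lift (Exp.app · b) fun _ _ => .app₁ b).trans (hb.lift (Exp.app a') fun _ _ => .app₂ a')

theorem upSubst {t u : ℕ → Exp S} (h : ∀ x, Steps (t x) (u x)) (x : ℕ) :
    Steps (upSubst t x) (upSubst u x) := by
  cases x with
  | zero => exact .refl
  | succ x => exact (h x).lift (Exp.rename Nat.succ) fun _ _ h => h.rename _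

theorem subst_right {t u : ℕ → Exp S} (h : ∀ x, Steps (t x) (u x)) (a : Exp S) :
    Steps (a.subst t) (a.subst u) := by
  induction a generalizing t u with
  | sort s => exact .refl
  | var x => exact h x
  | pi A B ihA ihB => exact (ihA h).pi (ihB (upSubst h))
  | lam A b ihA ihb => exact (ihA h).lam (ihb (upSubst h))
  | app a b iha ihb => exact (iha h).app (ihb h)

theorem inst_right {a a' : Exp S} (h : Steps a a') (b : Exp S) :
    Steps (inst b a) (inst b a') :=
  subst_right (fun x => by cases x with
    | zero => exact h
    | succ x => exact .refl) b

end Steps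

-- Parallel reduction and confluence

/-- Parallel `β`-reduction: any set of redexes is contracted at once. -/
inductive Par : Exp S → Exp S → Prop where
  | sort (s : S) : Par (.sort s) (.sort s)
  | var (x : ℕ) : Par (.var x) (.var x)
  | pi {A A' B B' : Exp S} : Par A A' → Par B B' → Par (.pi A B) (.pi A' B')
  | lam {A A' b b' : Exp S} : Par A A' → Par b b' → Par (.lam A b) (.lam A' b')
  | app {a a' b b' : Exp S} : Par a a' → Par b b' → Par (.app a b) (.app a' b')
  | beta (A : Exp S) {b b' a a' : Exp S} :
      Par b b' → Par a a' → Par (.app (.lam A b) a) (inst b' a')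

namespace Par

theorem refl (a : Exp S) : Par a a := by
  induction a with
  | sort s => exact .sort s
  | var x => exact .var x
  | pi A B ihA ihB => exact .pi ihA ihB
  | lam A b ihA ihb => exact .lam ihA ihb
  | app a b iha ihb => exact .app iha ihb

theorem of_step {a b : Exp S} (h : Step a b) : Par a b := by
  induction h with
  | beta A b a => exact .beta A (refl b) (refl a)
  | pi₁ B _ ih => exact .pi ih (refl B)
  | pi₂ A _ ih => exact .pi (refl A) ih
  | lam₁ b _ ih => exact .lam ih (refl b)
  | lam₂ A _ ih => exact .lam (refl A) ih
  | app₁ b _ ih => exact .app ih (refl b)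
  | app₂ a _ ih => exact .app (refl a) ih

theorem steps {a b : Exp S} (h : Par a b) : Steps a b := by
  induction h with
  | sort s => exact .refl
  | var x => exact .refl
  | pi _ _ ihA ihB => exact ihA.pi ihB
  | lam _ _ ihA ihb => exact ihA.lam ihb
  | app _ _ iha ihb => exact iha.app ihb
  | beta A _ _ ihb iha =>
    exact (Steps.app (Steps.lam .refl ihb) iha).tail (.beta _ _ _)

theorem rename {a b : Exp S} (h : Par a b) (r : ℕ → ℕ) : Par (a.rename r) (b.rename r) := by
  induction h generalizing r with
  | sort s => exact .sort s
  | var x => exact refl _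
  | pi _ _ ihA ihB => exact .pi (ihA r) (ihB _)
  | lam _ _ ihA ihb => exact .lam (ihA r) (ihb _)
  | app _ _ iha ihb => exact .app (iha r) (ihb r)
  | beta A _ _ ihb iha => rw [rename_inst]; exact .beta _ (ihb _) (iha r)

theorem upSubst {t u : ℕ → Exp S} (h : ∀ x, Par (t x) (u x)) (x : ℕ) :
    Par (upSubst t x) (upSubst u x) := by
  cases x with
  | zero => exact .var 0
  | succ x => exact (h x).rename _

theorem subst {a b : Exp S} (h : Par a b) {t u : ℕ → Exp S} (htu : ∀ x, Par (t x) (u x)) :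
    Par (a.subst t) (b.subst u) := by
  induction h generalizing t u with
  | sort s => exact .sort s
  | var x => exact htu x
  | pi _ _ ihA ihB => exact .pi (ihA htu) (ihB (upSubst htu))
  | lam _ _ ihA ihb => exact .lam (ihA htu) (ihb (upSubst htu))
  | app _ _ iha ihb => exact .app (iha htu) (ihb htu)
  | beta A _ _ ihb iha => rw [subst_inst]; exact .beta _ (ihb (upSubst htu)) (iha htu)

theorem inst {a a' b b' : Exp S} (hb : Par b b') (ha : Par a a') :
    Par (inst b a) (inst b' a') :=
  hb.subst fun x => by cases x with
    | zero => exact ha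
    | succ x => exact .var x

/-- The parallel contraction of all redexes of an expression. -/
def develop : Exp S → Exp S
  | .sort s => .sort s
  | .var x => .var x
  | .pi A B => .pi (develop A) (develop B)
  | .lam A b => .lam (develop A) (develop b)
  | .app (.lam _ b) a => Exp.inst (develop b) (develop a)
  | .app a b => .app (develop a) (develop b)

/-- Takahashi's triangle property: whatever redexes a parallel step leaves alone can still be
contracted afterwards. The diamond property follows, since the target depends on `a` only. -/
theorem to_develop {a b : Exp S} (h : Par a b) : Par b (develop a) := by
  induction h with
  | sort s => exact .sort s
  | var x => exact .var x
  | pi _ _ ihA ihB => exact .pi ihA ihB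
  | lam _ _ ihA ihb => exact .lam ihA ihb
  | beta A _ _ ihb iha => exact ihb.inst iha
  | @app a a' b b' ha hb iha ihb =>
    -- If `a` is an abstraction, `develop` contracts the head redex that this step kept; inverting
    -- both parallel steps of the abstraction exposes the bodies, and the redex is contracted now.
    cases a with
    | lam A c =>
      cases ha with
      | lam hA hc =>
        cases iha with
        | lam _ hc' => exact .beta _ hc' ihb
    | _ => exact .app iha ihb

end Par

theorem Steps.of_par {a b : Exp S} (h : ReflTransGen Par a b) : Steps a b := by
  induction h with
  | refl => exact .refl
  | tail _ h ih => exact ih.trans h.steps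

/-- The Church-Rosser theorem. -/
theorem Conv.join {a b : Exp S} (h : Conv a b) : Join Steps a b := by
  have cr : ∀ a b c : Exp S, Par a b → Par a c → ∃ d, ReflGen Par b d ∧ ReflTransGen Par c d :=
    fun a _ _ hb hc => ⟨_, .single hb.to_develop, .single hc.to_develop⟩
  have : Join (ReflTransGen Par) a b := by
    induction h with
    | rel a b h => exact ⟨b, .single (.of_step h), .refl⟩
    | refl a => exact ⟨a, .refl, .refl⟩
    | symm a b _ ih =>
      obtain ⟨c, hac, hbc⟩ := ih
      exact ⟨c, hbc, hac⟩
    | trans a b c _ _ ih₁ ih₂ =>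
      obtain ⟨d, had, hbd⟩ := ih₁
      obtain ⟨e, hbe, hce⟩ := ih₂
      obtain ⟨f, hdf, hef⟩ := church_rosser cr hbd hbe
      exact ⟨f, had.trans hdf, hce.trans hef⟩
  obtain ⟨c, hac, hbc⟩ := this
  exact ⟨c, .of_par hac, .of_par hbc⟩

-- Skeletons and classes

/-- Skeletons of kinds: what is left of a kind once the dependencies on objects are forgotten. -/
inductive Skel : Type where
  | star
  | arr (s t : Skel)
  | obj (t : Skel)
  deriving DecidableEq

/-- The classes of kinds (with their skeleton) and of type constructors (with the skeleton of
their kind). -/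
inductive Cls : Type where
  | knd (s : Skel)
  | typ (s : Skel)

namespace Cls

/-- The skeleton of a variable declared with a type of the given class; `none` for an object
variable. -/
def dom : Option Cls → Option Skel
  | some (knd s) => some s
  | _ => none

/-- The class of a product, from those of its domain and codomain. -/
def pi : Option Cls → Option Cls → Option Cls
  | some (knd s), some (knd t) => some (knd (.arr s t))
  | some (typ .star), some (knd t) => some (knd (.obj t))
  | some (knd _), some (typ .star) => some (typ .star)
  | some (typ .star), some (typ .star) => some (typ .star)
  | _, _ => none

/-- The class of an abstraction, from those of its domain and body. -/
def lam : Option Cls → Option Cls → Option Cls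
  | some (knd s), some (typ t) => some (typ (.arr s t))
  | some (typ .star), some (typ t) => some (typ (.obj t))
  | _, _ => none

/-- The class of an application, from those of the function and the argument. Arguments of
constructors that expect an object are unrestricted. -/
def app : Option Cls → Option Cls → Option Cls
  | some (typ (.arr s t)), some (typ s') => if s = s' then some (typ t) else none
  | some (typ (.obj t)), _ => some (typ t)
  | _, _ => none

/-- The skeleton of the semantic domain for a class. Kinds denote sets of expressions, just as
types do. -/
def skel : Cls → Skel
  | knd _ => .star
  | typ s => s

theorem pi_eq_some {c d : Option Cls} {k : Cls} (h : pi c d = some k) :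
    (∃ s t, c = some (knd s) ∧ d = some (knd t) ∧ k = knd (.arr s t)) ∨
    (∃ t, c = some (typ .star) ∧ d = some (knd t) ∧ k = knd (.obj t)) ∨
    (∃ s, c = some (knd s) ∧ d = some (typ .star) ∧ k = typ .star) ∨
    (c = some (typ .star) ∧ d = some (typ .star) ∧ k = typ .star) := by
  unfold pi at h
  split at h <;> simp_all

theorem lam_eq_some {c d : Option Cls} {k : Cls} (h : lam c d = some k) :
    (∃ s t, c = some (knd s) ∧ d = some (typ t) ∧ k = typ (.arr s t)) ∨
    (∃ t, c = some (typ .star) ∧ d = some (typ t) ∧ k = typ (.obj t)) := by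
  unfold lam at h
  split at h <;> simp_all

theorem app_eq_some {c d : Option Cls} {k : Cls} (h : app c d = some k) :
    (∃ s t, c = some (typ (.arr s t)) ∧ d = some (typ s) ∧ k = typ t) ∨
    (∃ t, c = some (typ (.obj t)) ∧ k = typ t) := by
  unfold app at h
  split at h <;> simp_all

end Cls

/-- The class of a kind or type constructor, given the skeletons of the constructor variables.
Objects and ill-formed expressions have none. -/
def cls : (ℕ → Option Skel) → Exp CCSort → Option Cls
  | _, .sort .star => some (.knd .star)
  | _, .sort .box => none
  | e, .var x => (e x).map .typ
  | e, .pi A B => Cls.pi (cls e A) (cls (scons (Cls.dom (cls e A)) e) B)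
  | e, .lam A b => Cls.lam (cls e A) (cls (scons (Cls.dom (cls e A)) e) b)
  | e, .app a b => Cls.app (cls e a) (cls e b)

theorem scons_comp_upRen {α : Type} (v : α) (e : ℕ → α) (r : ℕ → ℕ) :
    scons v e ∘ upRen r = scons v (e ∘ r) := by
  funext x; cases x <;> rfl

theorem cls_rename (a : Exp CCSort) (e : ℕ → Option Skel) (r : ℕ → ℕ) :
    cls e (a.rename r) = cls (e ∘ r) a := by
  induction a generalizing e r with
  | sort s => cases s <;> rfl
  | var x => rfl
  | pi A B ihA ihB => simp only [rename, cls, ihA, ihB, scons_comp_upRen]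
  | lam A b ihA ihb => simp only [rename, cls, ihA, ihb, scons_comp_upRen]
  | app a b iha ihb => simp only [rename, cls, iha, ihb]

theorem cls_shift (a : Exp CCSort) (e : ℕ → Option Skel) (o : Option Skel) :
    cls (scons o e) a.shift = cls e a :=
  cls_rename _ _ _

/-- `t` sends the constructor variables of `e` to constructors of the same skeleton. -/
def ClsSubst (e e' : ℕ → Option Skel) (t : ℕ → Exp CCSort) : Prop :=
  ∀ x s, e x = some s → cls e' (t x) = some (.typ s)

theorem ClsSubst.up {e e' : ℕ → Option Skel} {t : ℕ → Exp CCSort} (h : ClsSubst e e' t)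
    (o : Option Skel) : ClsSubst (scons o e) (scons o e') (upSubst t) := by
  intro x s hx
  cases x with
  | zero => exact congrArg (Option.map Cls.typ) hx
  | succ x => exact (cls_shift _ _ _).trans (h x s hx)

/-- Object variables may be replaced by anything: they have no class, so in a classified expression
they matter only inside arguments that `Cls.app` ignores. -/
theorem cls_subst {a : Exp CCSort} {c : Cls} {e e' : ℕ → Option Skel} {t : ℕ → Exp CCSort}
    (h : ClsSubst e e' t) (ha : cls e a = some c) : cls e' (a.subst t) = some c := by
  induction a generalizing e e' t c with
  | sort s => cases s <;> exact ha
  | var x =>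
    obtain ⟨s, hs, rfl⟩ := Option.map_eq_some_iff.1 ha
    exact h x s hs
  | pi A B ihA ihB =>
    simp only [cls, Exp.subst] at ha ⊢
    obtain ⟨s, t, hA, hB, rfl⟩ | ⟨t, hA, hB, rfl⟩ | ⟨s, hA, hB, rfl⟩ | ⟨hA, hB, rfl⟩ :=
      Cls.pi_eq_some ha <;>
    · rw [hA] at hB
      rw [ihA h hA, ihB (h.up _) hB]
      rfl
  | lam A b ihA ihb =>
    simp only [cls, Exp.subst] at ha ⊢
    obtain ⟨s, t, hA, hb, rfl⟩ | ⟨t, hA, hb, rfl⟩ := Cls.lam_eq_some ha <;>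
    · rw [hA] at hb
      rw [ihA h hA, ihb (h.up _) hb]
      rfl
  | app a b iha ihb =>
    simp only [cls, Exp.subst] at ha ⊢
    obtain ⟨s, t, hf, hb, rfl⟩ | ⟨t, hf, rfl⟩ := Cls.app_eq_some ha
    · rw [iha h hf, ihb h hb]
      exact if_pos rfl
    · rw [iha h hf]
      rfl

theorem clsSubst_single {e : ℕ → Option Skel} {a : Exp CCSort} {o : Option Skel}
    (h : ∀ s, o = some s → cls e a = some (.typ s)) : ClsSubst (scons o e) e (single a) := by
  intro x s hx
  cases x with
  | zero => exact h s hx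
  | succ x => exact congrArg (Option.map Cls.typ) hx

/-- The `β` case is `cls_subst`. Only this direction holds: a redex may discard an unclassifiable
part, so that a class appears. -/
theorem Step.cls_eq {a a' : Exp CCSort} (h : Step a a') {e : ℕ → Option Skel} {c : Cls}
    (ha : cls e a = some c) : cls e a' = some c := by
  induction h generalizing e c with
  | beta A b a =>
    simp only [cls] at ha
    obtain ⟨s, t, hf, ha', rfl⟩ | ⟨t, hf, rfl⟩ := Cls.app_eq_some ha
    · obtain ⟨s', t', hA, hb, h⟩ | ⟨t', hA, hb, h⟩ := Cls.lam_eq_some hf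
      · cases h
        rw [hA] at hb
        exact cls_subst (clsSubst_single fun _ h => by cases h; exact ha') hb
      · cases h
    · obtain ⟨s', t', hA, hb, h⟩ | ⟨t', hA, hb, h⟩ := Cls.lam_eq_some hf
      · cases h
      · cases h
        rw [hA] at hb
        exact cls_subst (clsSubst_single fun _ h => by cases h) hb
  | pi₁ B _ ih =>
    simp only [cls] at ha ⊢
    obtain ⟨s, t, hA, hB, -⟩ | ⟨t, hA, hB, -⟩ | ⟨s, hA, hB, -⟩ | ⟨hA, hB, -⟩ :=
      Cls.pi_eq_some ha <;>
    · rw [ih hA, ← hA]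
      exact ha
  | pi₂ A _ ih =>
    simp only [cls] at ha ⊢
    obtain ⟨s, t, hA, hB, -⟩ | ⟨t, hA, hB, -⟩ | ⟨s, hA, hB, -⟩ | ⟨hA, hB, -⟩ :=
      Cls.pi_eq_some ha <;>
    · rw [ih hB, ← hB]
      exact ha
  | lam₁ b _ ih =>
    simp only [cls] at ha ⊢
    obtain ⟨s, t, hA, hb, -⟩ | ⟨t, hA, hb, -⟩ := Cls.lam_eq_some ha <;>
    · rw [ih hA, ← hA]
      exact ha
  | lam₂ A _ ih =>
    simp only [cls] at ha ⊢
    obtain ⟨s, t, hA, hb, -⟩ | ⟨t, hA, hb, -⟩ := Cls.lam_eq_some ha <;>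
    · rw [ih hb, ← hb]
      exact ha
  | app₁ b _ ih =>
    simp only [cls] at ha ⊢
    obtain ⟨s, t, hf, hb, -⟩ | ⟨t, hf, rfl⟩ := Cls.app_eq_some ha <;>
    · rw [ih hf, ← hf]
      exact ha
  | app₂ a _ ih =>
    simp only [cls] at ha ⊢
    obtain ⟨s, t, hf, hb, -⟩ | ⟨t, hf, rfl⟩ := Cls.app_eq_some ha
    · rw [ih hb, ← hb]
      exact ha
    · rw [hf]
      rfl

theorem Steps.cls_eq {a a' : Exp CCSort} (h : Steps a a') {e : ℕ → Option Skel} {c : Cls}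
    (ha : cls e a = some c) : cls e a' = some c := by
  induction h with
  | refl => exact ha
  | tail _ h ih => exact h.cls_eq ih

-- Classes of typed expressions

/-- The skeletons of the variables of a context. -/
def clsEnv : Ctx CCSort → ℕ → Option Skel
  | [] => fun _ => none
  | A :: Γ => scons (Cls.dom (cls (clsEnv Γ) A)) (clsEnv Γ)

/-- The possible classes of the subject and the type of a typing judgement. -/
def ClsTyping (e : ℕ → Option Skel) (a A : Exp CCSort) : Prop :=
  (A = .sort .box ∧ ∃ s, cls e a = some (.knd s)) ∨
  (∃ s, cls e A = some (.knd s) ∧ cls e a = some (.typ s)) ∨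
  cls e A = some (.typ .star)

/-- `A` is a kind or a type. -/
def IsDom (e : ℕ → Option Skel) (A : Exp CCSort) : Prop :=
  (∃ s, cls e A = some (.knd s)) ∨ cls e A = some (.typ .star)

theorem ClsTyping.sort_iff {e : ℕ → Option Skel} {A : Exp CCSort} {s : CCSort} :
    ClsTyping e A (.sort s) ↔
      (s = .box ∧ ∃ k, cls e A = some (.knd k)) ∨ (s = .star ∧ cls e A = some (.typ .star)) := by
  cases s <;> simp [ClsTyping, cls]

theorem ClsTyping.isDom {e : ℕ → Option Skel} {A : Exp CCSort} {s : CCSort}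
    (h : ClsTyping e A (.sort s)) : IsDom e A := by
  rcases ClsTyping.sort_iff.1 h with h | h
  · exact .inl h.2
  · exact .inr h.2

/-- The class of an argument fits the domain. -/
theorem ClsTyping.of_dom {e : ℕ → Option Skel} {a A : Exp CCSort} (h : ClsTyping e a A) (s : Skel)
    (hs : Cls.dom (cls e A) = some s) : cls e a = some (.typ s) := by
  obtain ⟨rfl, -⟩ | ⟨k, hA, ha⟩ | hA := h
  · simp [cls, Cls.dom] at hs
  · rw [hA] at hs
    cases hs
    exact ha
  · rw [hA] at hs
    cases hs

/-- The types of all variables of `Γ` are kinds or types, as recorded in `clsEnv Γ`. -/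
def CtxDom (Γ : Ctx CCSort) : Prop :=
  ∀ x A, Lookup Γ x A → IsDom (clsEnv Γ) A ∧ Cls.dom (cls (clsEnv Γ) A) = clsEnv Γ x

theorem CtxDom.cons {Γ : Ctx CCSort} {A : Exp CCSort} (h : CtxDom Γ) (hA : IsDom (clsEnv Γ) A) :
    CtxDom (A :: Γ) := by
  intro x B hx
  cases hx with
  | zero =>
    simp only [IsDom, clsEnv, cls_shift] at hA ⊢
    exact ⟨hA, rfl⟩
  | succ _ hx =>
    have := h _ _ hx
    simp only [IsDom, clsEnv, cls_shift] at this ⊢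
    exact this

/-- A conversion may pass through expressions without a class, so the classes are compared at a
common reduct. -/
theorem Conv.cls_eq {A B : Exp CCSort} (h : Conv A B) {e : ℕ → Option Skel} {c d : Cls}
    (hA : cls e A = some c) (hB : cls e B = some d) : c = d := by
  obtain ⟨C, hAC, hBC⟩ := h.join
  exact Option.some.inj ((hAC.cls_eq hA).symm.trans (hBC.cls_eq hB))

theorem steps_sort {s : CCSort} {a : Exp CCSort} (h : Steps (.sort s) a) : a = .sort s := by
  induction h with
  | refl => rfl
  | tail _ h ih => subst ih; cases h

/-- `□` reduces only to itself and has no class, while every reduct of `B` has one. -/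
theorem Conv.ne_box {A B : Exp CCSort} (h : Conv A B) {e : ℕ → Option Skel} {d : Cls}
    (hB : cls e B = some d) : A ≠ .sort .box := by
  rintro rfl
  obtain ⟨C, hAC, hBC⟩ := h.join
  have := hBC.cls_eq hB
  rw [steps_sort hAC] at this
  cases this

theorem IsDom.exists_cls {e : ℕ → Option Skel} {A : Exp CCSort} (h : IsDom e A) :
    ∃ c, cls e A = some c ∧ c.skel = .star := by
  obtain ⟨s, h⟩ | h := h <;> exact ⟨_, h, rfl⟩

theorem ClsTyping.var {e : ℕ → Option Skel} {A : Exp CCSort} {x : ℕ} (h : IsDom e A)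
    (hx : Cls.dom (cls e A) = e x) : ClsTyping e (.var x) A := by
  obtain ⟨s, hA⟩ | hA := h
  · rw [hA] at hx
    exact .inr (.inl ⟨s, hA, congrArg (Option.map Cls.typ) hx.symm⟩)
  · exact .inr (.inr hA)

theorem ClsTyping.pi {e : ℕ → Option Skel} {A B : Exp CCSort} {s₁ s₂ s₃ : CCSort}
    (hA : ClsTyping e A (.sort s₁)) (hB : ClsTyping (scons (Cls.dom (cls e A)) e) B (.sort s₂))
    (h : (s₁, s₂, s₃) ∈ CC.rules) : ClsTyping e (.pi A B) (.sort s₃) := by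
  -- In every rule the codomain alone decides whether the product is a kind or a type.
  have : s₃ = s₂ := by
    simp only [CC, Set.mem_insert_iff, Set.mem_singleton_iff, Prod.mk.injEq] at h
    rcases h with h | h | h | h <;> rw [h.2.1, h.2.2]
  subst this
  rw [sort_iff] at hB ⊢
  obtain ⟨s, hA⟩ | hA := hA.isDom <;> obtain ⟨rfl, t, hB⟩ | ⟨rfl, hB⟩ := hB <;>
    simp only [cls, hB] <;> simp [hA, Cls.pi]

theorem ClsTyping.lam {e : ℕ → Option Skel} {A B b : Exp CCSort} (hAB : IsDom e (.pi A B))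
    (hb : ClsTyping (scons (Cls.dom (cls e A)) e) b B) : ClsTyping e (.lam A b) (.pi A B) := by
  obtain ⟨u, hAB⟩ | hAB := hAB
  · refine .inr (.inl ⟨u, hAB, ?_⟩)
    simp only [cls] at hAB ⊢
    obtain ⟨rfl, -⟩ | ⟨t, hB, hb⟩ | hB := hb
    · rcases Cls.pi_eq_some hAB with h | h | h | h <;> simp [cls] at h
    · rw [hb]
      rw [hB] at hAB
      obtain ⟨s, t, hA, h, h'⟩ | ⟨t, hA, h, h'⟩ | ⟨s, hA, h, h'⟩ | ⟨hA, h, h'⟩ :=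
        Cls.pi_eq_some hAB <;> cases h <;> cases h' <;> rw [hA] <;> rfl
    · rw [hB] at hAB
      rcases Cls.pi_eq_some hAB with h | h | h | h <;> simp at h
  · exact .inr (.inr hAB)

theorem ClsTyping.app {e : ℕ → Option Skel} {A B a b : Exp CCSort} (ha : ClsTyping e a (.pi A B))
    (hb : ClsTyping e b A) : ClsTyping e (.app a b) (inst B b) := by
  have hs := clsSubst_single hb.of_dom
  obtain ⟨h, -⟩ | ⟨u, hAB, ha⟩ | hAB := ha
  · cases h
  · simp only [cls] at hAB
    obtain ⟨s, t, hA, hB, h⟩ | ⟨t, hA, hB, h⟩ | ⟨s, hA, hB, h⟩ | ⟨hA, hB, h⟩ :=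
      Cls.pi_eq_some hAB
    · cases h
      refine .inr (.inl ⟨t, cls_subst hs hB, ?_⟩)
      simp [cls, ha, hb.of_dom s (by rw [hA]; rfl), Cls.app]
    · cases h
      exact .inr (.inl ⟨t, cls_subst hs hB, by simp [cls, ha, Cls.app]⟩)
    · cases h
    · cases h
  · simp only [cls] at hAB
    obtain ⟨s, t, hA, hB, h⟩ | ⟨t, hA, hB, h⟩ | ⟨s, hA, hB, h⟩ | ⟨hA, hB, h⟩ :=
      Cls.pi_eq_some hAB
    · cases h
    · cases h
    · exact .inr (.inr (cls_subst hs hB))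
    · exact .inr (.inr (cls_subst hs hB))

theorem ClsTyping.conv {e : ℕ → Option Skel} {A B a : Exp CCSort} (ha : ClsTyping e a A)
    (hB : IsDom e B) (h : Conv A B) : ClsTyping e a B := by
  obtain ⟨c, hc, -⟩ := hB.exists_cls
  obtain ⟨rfl, -⟩ | ⟨s, hA, ha⟩ | hA := ha
  · exact absurd rfl (h.ne_box hc)
  · have := h.cls_eq hA hc
    subst this
    exact .inr (.inl ⟨s, hc, ha⟩)
  · have := h.cls_eq hA hc
    subst this
    exact .inr (.inr hc)

theorem Typing.ctxDom_and_cls {Γ : Ctx CCSort} {a A : Exp CCSort} (h : Typing CC Γ a A) :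
    CtxDom Γ ∧ ClsTyping (clsEnv Γ) a A := by
  refine Typing.rec (P := CC) (motive_1 := fun Γ _ => CtxDom Γ)
    (motive_2 := fun Γ a A _ => CtxDom Γ ∧ ClsTyping (clsEnv Γ) a A)
    ?_ ?_ ?_ ?_ ?_ ?_ ?_ ?_ h
  · rintro x A ⟨⟩
  · rintro Γ A s - ⟨hΓ, hA⟩
    exact hΓ.cons hA.isDom
  · rintro Γ s₁ s₂ - h hΓ
    cases h
    exact ⟨hΓ, .inl ⟨rfl, _, rfl⟩⟩
  · rintro Γ x A - hx hΓ
    exact ⟨hΓ, .var (hΓ x A hx).1 (hΓ x A hx).2⟩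
  · rintro Γ A B s₁ s₂ s₃ - - h ⟨hΓ, hA⟩ ⟨-, hB⟩
    exact ⟨hΓ, .pi hA hB h⟩
  · rintro Γ A B b s - - ⟨hΓ, hAB⟩ ⟨-, hb⟩
    exact ⟨hΓ, .lam hAB.isDom hb⟩
  · rintro Γ A B a b - - ⟨hΓ, ha⟩ ⟨-, hb⟩
    exact ⟨hΓ, .app ha hb⟩
  · rintro Γ A B a s - - h ⟨hΓ, ha⟩ ⟨-, hB⟩
    exact ⟨hΓ, .conv ha hB.isDom h⟩

theorem Typing.cls {Γ : Ctx CCSort} {a A : Exp CCSort} (h : Typing CC Γ a A) :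
    ClsTyping (clsEnv Γ) a A :=
  h.ctxDom_and_cls.2

-- Strong normalization and reducibility candidates

/-- Strong normalization as accessibility. -/
def Norm (a : Exp S) : Prop := Acc (fun a b => Step b a) a

namespace Norm

theorem step {a b : Exp S} (h : Norm a) (hab : Step a b) : Norm b := h.inv hab

theorem mem_SN {a : Exp S} (h : Norm a) : a ∈ SN := by
  induction h with
  | intro a _ ih =>
    rintro ⟨f, rfl, hf⟩
    exact ih (f 1) (hf 0) ⟨fun n => f (n + 1), rfl, fun n => hf (n + 1)⟩

theorem of_map {f : Exp S → Exp S} (hf : ∀ a b, Step a b → Step (f a) (f b)) {a : Exp S}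
    (h : Norm (f a)) : Norm a :=
  Subrelation.accessible (fun {a b} h => hf b a h) (InvImage.accessible f h)

theorem sort (s : S) : Norm (.sort s) := ⟨_, fun _ h => nomatch h⟩

theorem pi {A B : Exp S} (hA : Norm A) (hB : Norm B) : Norm (.pi A B) := by
  induction hA generalizing B with
  | intro A _ ihA =>
    induction hB with
    | intro B hB ihB =>
      refine ⟨_, fun c hc => ?_⟩
      cases hc with
      | pi₁ _ h => exact ihA _ h ⟨B, hB⟩
      | pi₂ _ h => exact ihB _ h

theorem of_inst_var {b : Exp S} {x : ℕ} (h : Norm (inst b (.var x))) : Norm b :=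
  of_map (fun _ _ h => h.subst _) h

end Norm

/-- Girard's reducibility candidates. -/
structure Cand where
  carrier : Set (Exp CCSort)
  norm : ∀ a ∈ carrier, Norm a
  step : ∀ a ∈ carrier, ∀ b, Step a b → b ∈ carrier
  expand : ∀ a, (∀ A b, a ≠ lam A b) → (∀ b, Step a b → b ∈ carrier) → a ∈ carrier

namespace Cand

instance : Membership (Exp CCSort) Cand := ⟨fun X a => a ∈ X.carrier⟩

theorem steps {X : Cand} {a b : Exp CCSort} (h : Steps a b) (ha : a ∈ X) : b ∈ X := by
  induction h with
  | refl => exact ha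
  | tail _ h ih => exact X.step _ ih _ h

theorem var_mem (X : Cand) (x : ℕ) : var x ∈ X :=
  X.expand _ (fun _ _ h => nomatch h) fun _ h => nomatch h

/-- The candidate of all strongly normalizing expressions. -/
instance : Inhabited Cand where
  default :=
    { carrier := {a | Norm a}
      norm := fun _ h => h
      step := fun _ h _ hab => Norm.step h hab
      expand := fun _ _ h => ⟨_, h⟩ }

/-- The candidate of functions from `X` to `Y`. -/
def arrow (X Y : Cand) : Cand where
  carrier := {f | ∀ a ∈ X, app f a ∈ Y}
  norm f hf := Norm.of_map (fun _ _ h => .app₁ (var 0) h) (Y.norm _ (hf _ (X.var_mem 0)))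
  step f hf g hfg a ha := Y.step _ (hf a ha) _ (.app₁ a hfg)
  expand f hf h a ha := by
    -- Induction on the normalization of the argument handles the steps inside it; no `β`-step
    -- arises at the root, as `f` is not an abstraction.
    have hn := X.norm a ha
    induction hn with
    | intro a _ ih =>
      refine Y.expand _ (fun _ _ h => nomatch h) fun c hc => ?_
      cases hc with
      | beta A b _ => exact absurd rfl (hf A b)
      | app₁ _ h' => exact h _ h' a ha
      | app₂ _ h' => exact ih _ h' (X.step _ ha _ h')

/-- The intersection of a family of candidates. -/
def inf {ι : Type} [Inhabited ι] (X : ι → Cand) : Cand where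
  carrier := {a | ∀ i, a ∈ X i}
  norm a ha := (X default).norm a (ha default)
  step a ha b hab i := (X i).step a (ha i) b hab
  expand a h h' i := (X i).expand a h fun b hb => h' b hb i

/-- A redex is not an abstraction, so its one-step reducts suffice; nested induction treats those in
`A`, `b` and `a`. The contractum forgets `A` and possibly `a`, whence their separate normalization.
A step in `a` becomes several steps of the contractum, one per occurrence. -/
theorem redex_mem {Y : Cand} {A b a : Exp CCSort} (hA : Norm A) (hb : Norm b) (ha : Norm a)
    (h : inst b a ∈ Y) : app (lam A b) a ∈ Y := by
  induction hA generalizing b a with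
  | intro A hA ihA =>
    induction hb generalizing a with
    | intro b hb ihb =>
      induction ha with
      | intro a ha iha =>
        refine Y.expand _ (fun _ _ h => nomatch h) fun c hc => ?_
        cases hc with
        | beta => exact h
        | app₁ _ h' =>
          cases h' with
          | lam₁ _ h' => exact ihA _ h' ⟨b, hb⟩ ⟨a, ha⟩ h
          | lam₂ _ h' => exact ihb _ h' ⟨a, ha⟩ (Y.step _ h _ (h'.subst _))
        | app₂ _ h' => exact iha _ h' (steps (Steps.inst_right (.single h') b) h)

end Cand

-- Interpretation of kinds and constructors

/-- The semantic domain of the constructors whose kind has the given skeleton. -/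
def Dom : Skel → Type
  | .star => Cand
  | .arr s t => Dom s → Dom t
  | .obj t => Dom t

instance Dom.instInhabited : (s : Skel) → Inhabited (Dom s)
  | .star => inferInstanceAs (Inhabited Cand)
  | .arr _ t => ⟨fun _ => (instInhabited t).default⟩
  | .obj t => instInhabited t

/-- Semantic values, with a component for every skeleton; only the one at the skeleton of the
expression that is interpreted matters. -/
abbrev Val : Type := ∀ s, Dom s

/-- The value with component `v` at `s`. -/
def Val.at (s : Skel) (v : Dom s) : Val := Function.update default s v

theorem Val.at_self (s : Skel) (v : Dom s) : Val.at s v s = v := Function.update_self ..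

/-- The candidate of a product, from the class of its domain. -/
def piCand (c : Option Cls) (X : Cand) (Y : Val → Cand) : Cand :=
  match c with
  | some (.knd s) => X.arrow (.inf fun v : Dom s => Y (.at s v))
  | _ => X.arrow (Y default)

/-- The component at `t` of an application, from the class of the function. -/
def appVal (c : Option Cls) (t : Skel) (f a : Val) : Dom t :=
  match c with
  | some (.typ (.arr s _)) => f (.arr s t) (a s)
  | _ => f (.obj t)

/-- The interpretation of kinds and types (as candidates) and of type constructors, given the
skeletons and values of the constructor variables. -/
def interp : (ℕ → Option Skel) → (ℕ → Val) → Exp CCSort → Val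
  | _, _, .sort _ => default
  | _, r, .var x => r x
  | e, r, .pi A B => fun
    | .star => piCand (cls e A) (interp e r A .star) fun v =>
        interp (scons (Cls.dom (cls e A)) e) (scons v r) B .star
    | _ => default
  | e, r, .lam _ b => fun
    | .star => default
    | .arr s t => fun v => interp (scons (some s) e) (scons (.at s v) r) b t
    | .obj t => interp (scons none e) (scons default r) b t
  | e, r, .app a b => fun t => appVal (cls e a) t (interp e r a) (interp e r b)

/-- The candidate of a kind or type. -/
def interpCand (e : ℕ → Option Skel) (r : ℕ → Val) (A : Exp CCSort) : Cand := interp e r A .star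

theorem interp_pi (e : ℕ → Option Skel) (r : ℕ → Val) (A B : Exp CCSort) :
    interp e r (.pi A B) .star = piCand (cls e A) (interpCand e r A) fun v =>
      interpCand (scons (Cls.dom (cls e A)) e) (scons v r) B :=
  rfl

theorem interp_app (e : ℕ → Option Skel) (r : ℕ → Val) (a b : Exp CCSort) (t : Skel) :
    interp e r (.app a b) t = appVal (cls e a) t (interp e r a) (interp e r b) :=
  rfl

theorem interp_rename (a : Exp CCSort) (e : ℕ → Option Skel) (r : ℕ → Val) (q : ℕ → ℕ) :
    interp e r (a.rename q) = interp (e ∘ q) (r ∘ q) a := by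
  induction a generalizing e r q with
  | sort s => rfl
  | var x => rfl
  | pi A B ihA ihB => simp only [rename, interp, ihA, ihB, cls_rename, scons_comp_upRen]
  | lam A b ihA ihb => simp only [rename, interp, ihb, scons_comp_upRen]
  | app a b iha ihb => simp only [rename, interp, iha, ihb, cls_rename]

theorem interp_shift (a : Exp CCSort) (e : ℕ → Option Skel) (r : ℕ → Val) (o : Option Skel)
    (v : Val) : interp (scons o e) (scons v r) a.shift = interp e r a :=
  interp_rename _ _ _ _

/-- The values `r` are those of the substitution `t`, at the relevant skeletons. -/
def ValSubst (e : ℕ → Option Skel) (r : ℕ → Val) (e' : ℕ → Option Skel) (r' : ℕ → Val)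
    (t : ℕ → Exp CCSort) : Prop :=
  ∀ x s, e x = some s → interp e' r' (t x) s = r x s

theorem ValSubst.up {e e' : ℕ → Option Skel} {r r' : ℕ → Val} {t : ℕ → Exp CCSort}
    (h : ValSubst e r e' r' t) (o : Option Skel) (v : Val) :
    ValSubst (scons o e) (scons v r) (scons o e') (scons v r') (upSubst t) := by
  intro x s hx
  cases x with
  | zero => rfl
  | succ x => exact (congrFun (interp_shift _ _ _ _ _) s).trans (h x s hx)

/-- Equality is claimed only at the skeleton of the class, where substituted and assigned values
agree. `cls_subst` ensures that both sides take the same branch in `piCand` and `appVal`. -/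
theorem interp_subst {a : Exp CCSort} {c : Cls} {e e' : ℕ → Option Skel} {r r' : ℕ → Val}
    {t : ℕ → Exp CCSort} (ht : ClsSubst e e' t) (h : ValSubst e r e' r' t)
    (ha : cls e a = some c) : interp e' r' (a.subst t) c.skel = interp e r a c.skel := by
  induction a generalizing e e' r r' t c with
  | sort s => rfl
  | var x =>
    obtain ⟨s, hs, rfl⟩ := Option.map_eq_some_iff.1 ha
    exact h x s hs
  | pi A B ihA ihB =>
    simp only [cls] at ha
    obtain ⟨s, u, hA, hB, rfl⟩ | ⟨u, hA, hB, rfl⟩ | ⟨s, hA, hB, rfl⟩ | ⟨hA, hB, rfl⟩ :=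
      Cls.pi_eq_some ha <;>
    · have h₂ := fun v => ihB (ht.up _) (h.up _ v) hB
      rw [hA] at h₂
      refine (interp_pi e' r' _ _).trans (Eq.trans ?_ (interp_pi e r A B).symm)
      rw [cls_subst ht hA, hA]
      exact congrArg₂ (piCand _) (ihA ht h hA) (funext h₂)
  | lam A b ihA ihb =>
    simp only [cls] at ha
    obtain ⟨s, u, hA, hb, rfl⟩ | ⟨u, hA, hb, rfl⟩ := Cls.lam_eq_some ha
    · rw [hA] at hb
      funext v
      exact ihb (ht.up _) (h.up _ _) hb
    · rw [hA] at hb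
      exact ihb (ht.up _) (h.up _ _) hb
  | app a b iha ihb =>
    simp only [cls] at ha
    rw [Exp.subst, interp_app, interp_app]
    obtain ⟨s, u, hf, hb, rfl⟩ | ⟨u, hf, rfl⟩ := Cls.app_eq_some ha
    · rw [cls_subst ht hf, hf]
      exact congr (α := Dom s) (β := Dom u) (iha ht h hf) (ihb ht h hb)
    · rw [cls_subst ht hf, hf]
      exact iha ht h hf

theorem interp_inst {b a : Exp CCSort} {c : Cls} {e : ℕ → Option Skel} {r : ℕ → Val}
    {o : Option Skel} {v : Val} (ha : ∀ s, o = some s → cls e a = some (.typ s))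
    (hv : ∀ s, o = some s → interp e r a s = v s) (hb : cls (scons o e) b = some c) :
    interp e r (inst b a) c.skel = interp (scons o e) (scons v r) b c.skel :=
  interp_subst (clsSubst_single ha)
    (fun x s hx => by cases x with
      | zero => exact hv s hx
      | succ x => rfl) hb

theorem Step.interp_eq {a a' : Exp CCSort} (h : Step a a') {e : ℕ → Option Skel} {r : ℕ → Val}
    {c : Cls} (ha : cls e a = some c) : interp e r a' c.skel = interp e r a c.skel := by
  induction h generalizing e r c with
  | beta A b a =>
    simp only [cls] at ha
    rw [interp_app, cls]
    obtain ⟨s, u, hf, ha', rfl⟩ | ⟨u, hf, rfl⟩ := Cls.app_eq_some ha <;> rw [hf]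
    · obtain ⟨s', u', hA, hb, h⟩ | ⟨u', hA, hb, h⟩ := Cls.lam_eq_some hf
      · cases h
        rw [hA] at hb
        exact interp_inst (fun _ h => by cases h; exact ha')
          (fun _ h => by cases h; exact (Val.at_self _ _).symm) hb
      · cases h
    · obtain ⟨s', u', hA, hb, h⟩ | ⟨u', hA, hb, h⟩ := Cls.lam_eq_some hf
      · cases h
      · cases h
        rw [hA] at hb
        exact interp_inst (fun _ h => by cases h) (fun _ h => by cases h) hb
  | pi₁ B hs ih =>
    simp only [cls] at ha
    obtain ⟨s, u, hA, hB, rfl⟩ | ⟨u, hA, hB, rfl⟩ | ⟨s, hA, hB, rfl⟩ | ⟨hA, hB, rfl⟩ :=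
      Cls.pi_eq_some ha <;>
    · refine (interp_pi e r _ _).trans (Eq.trans ?_ (interp_pi e r _ _).symm)
      rw [hs.cls_eq hA, hA]
      exact congrArg₂ (piCand _) (ih hA) rfl
  | pi₂ A _ ih =>
    simp only [cls] at ha
    obtain ⟨s, u, hA, hB, rfl⟩ | ⟨u, hA, hB, rfl⟩ | ⟨s, hA, hB, rfl⟩ | ⟨hA, hB, rfl⟩ :=
      Cls.pi_eq_some ha <;>
    · refine (interp_pi e r _ _).trans (Eq.trans ?_ (interp_pi e r _ _).symm)
      exact congrArg (piCand _ _) (funext fun v => ih hB)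
  -- The value of an abstraction ignores its annotation: the skeleton of the bound variable is read
  -- off the requested component.
  | lam₁ b _ ih => rfl
  | lam₂ A _ ih =>
    simp only [cls] at ha
    obtain ⟨s, u, hA, hb, rfl⟩ | ⟨u, hA, hb, rfl⟩ := Cls.lam_eq_some ha
    · rw [hA] at hb
      funext v
      exact ih hb
    · rw [hA] at hb
      exact ih hb
  | app₁ b hs ih =>
    simp only [cls] at ha
    rw [interp_app, interp_app]
    obtain ⟨s, u, hf, hb, rfl⟩ | ⟨u, hf, rfl⟩ := Cls.app_eq_some ha <;> rw [hs.cls_eq hf, hf]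
    · exact congr (α := Dom s) (β := Dom u) (ih hf) rfl
    · exact ih hf
  | app₂ a _ ih =>
    simp only [cls] at ha
    rw [interp_app, interp_app]
    obtain ⟨s, u, hf, hb, rfl⟩ | ⟨u, hf, rfl⟩ := Cls.app_eq_some ha <;> rw [hf]
    · exact congr (α := Dom s) (β := Dom u) rfl (ih hb)
    · rfl

theorem Steps.interp_eq {a a' : Exp CCSort} (h : Steps a a') {e : ℕ → Option Skel} {r : ℕ → Val}
    {c : Cls} (ha : cls e a = some c) : interp e r a' c.skel = interp e r a c.skel := by
  induction h with
  | refl => rfl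
  | tail h h' ih => exact (h'.interp_eq (Steps.cls_eq h ha)).trans ih

theorem Conv.interp_eq {A B : Exp CCSort} (h : Conv A B) {e : ℕ → Option Skel} {r : ℕ → Val}
    {c d : Cls} (hA : cls e A = some c) (hB : cls e B = some d) :
    interp e r A c.skel = interp e r B c.skel := by
  obtain rfl := h.cls_eq hA hB
  obtain ⟨C, hAC, hBC⟩ := h.join
  exact (hAC.interp_eq hA).symm.trans (hBC.interp_eq hB)

-- Soundness of the interpretation

/-- The expressions `t` belong to the interpretations of the types declared in `Γ`. -/
def Realizes (Γ : Ctx CCSort) (r : ℕ → Val) (t : ℕ → Exp CCSort) : Prop :=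
  ∀ x A, Lookup Γ x A → t x ∈ interpCand (clsEnv Γ) r A

/-- The value `v` and the realizer `a` need not be related; this independence matches the
intersection in `piCand`. -/
theorem Realizes.cons {Γ : Ctx CCSort} {r : ℕ → Val} {t : ℕ → Exp CCSort} {a A : Exp CCSort}
    (h : Realizes Γ r t) (v : Val) (ha : a ∈ interpCand (clsEnv Γ) r A) :
    Realizes (A :: Γ) (scons v r) (scons a t) := by
  intro x B hx
  cases hx with
  | zero =>
    rw [interpCand, show clsEnv (A :: Γ) = scons _ (clsEnv Γ) from rfl, interp_shift]
    exact ha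
  | succ _ hx =>
    rw [interpCand, show clsEnv (A :: Γ) = scons _ (clsEnv Γ) from rfl, interp_shift]
    exact h _ _ hx

theorem Norm.of_pi {A B : Exp S} (h : Norm (.pi A B)) : Norm A :=
  of_map (f := (Exp.pi · B)) (fun _ _ h => .pi₁ B h) h

/-- The values of a constructor argument allowed by a product, from the class of its domain. -/
def Admissible (c : Option Cls) (v : Val) : Prop :=
  match c with
  | some (.knd s) => ∃ w, v = Val.at s w
  | _ => v = default

theorem mem_piCand {c : Option Cls} {X : Cand} {Y : Val → Cand} {f : Exp CCSort} :
    f ∈ piCand c X Y ↔ ∀ a ∈ X, ∀ v, Admissible c v → app f a ∈ Y v := by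
  unfold piCand Admissible
  split
  · exact ⟨fun h a ha v ⟨w, hw⟩ => hw ▸ h a ha w, fun h a ha w => h a ha _ ⟨w, rfl⟩⟩
  · exact ⟨fun h a ha v hv => hv ▸ h a ha, fun h a ha => h a ha _ rfl⟩

/-- Cuts an arbitrary value down to its component at the skeleton of the domain, the only one that
matters in the codomain. -/
theorem exists_admissible (c : Option Cls) (w : Val) :
    ∃ v, Admissible c v ∧ ∀ s, Cls.dom c = some s → w s = v s := by
  unfold Admissible
  split
  · exact ⟨_, ⟨w _, rfl⟩, fun s h => by cases h; exact (Val.at_self _ _).symm⟩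
  · rename_i hc
    refine ⟨_, rfl, fun s h => ?_⟩
    unfold Cls.dom at h
    split at h
    · exact absurd rfl (hc _)
    · cases h

/-- Every typed expression realizes the interpretation of its type. -/
theorem Typing.realizes {Γ : Ctx CCSort} {a A : Exp CCSort} (h : Typing CC Γ a A) :
    ∀ r t, Realizes Γ r t → a.subst t ∈ interpCand (clsEnv Γ) r A := by
  refine Typing.rec (P := CC) (motive_1 := fun _ _ => True)
    (motive_2 := fun Γ a A _ => ∀ r t, Realizes Γ r t → a.subst t ∈ interpCand (clsEnv Γ) r A)
    ?_ ?_ ?_ ?_ ?_ ?_ ?_ ?_ h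
  · trivial
  · exact fun _ _ => trivial
  · intro Γ s₁ s₂ _ _ _ r t _
    exact Norm.sort s₁
  · intro Γ x A _ hx _ r t h
    exact h x A hx
  · intro Γ A B s₁ s₂ s₃ _ _ _ ihA ihB r t h
    -- A variable realizes the domain, with any value. Normalization of the instance passes back to
    -- `B`, since substitution preserves steps.
    have hB := ihB _ _ (h.cons default (Cand.var_mem _ 0))
    rw [← inst_subst_upSubst] at hB
    exact Norm.pi (ihA r t h) (Norm.of_inst_var hB)
  · intro Γ A B b s _ _ ihAB ihb r t h
    refine mem_piCand.2 fun a ha v _ => ?_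
    have key : ∀ a ∈ interpCand (clsEnv Γ) r A, ∀ v, inst (b.subst (upSubst t)) a ∈
        interpCand (clsEnv (A :: Γ)) (scons v r) B := fun a ha v => by
      rw [inst_subst_upSubst]
      exact ihb _ _ (h.cons v ha)
    exact Cand.redex_mem (Norm.of_pi (ihAB r t h))
      (Norm.of_inst_var (Cand.norm _ _ (key _ (Cand.var_mem _ 0) v))) (Cand.norm _ _ ha)
      (key a ha v)
  · intro Γ A B a b ha hb iha ihb r t h
    -- The intersection is instantiated at the value of the argument `b`, so that `interp_inst`
    -- identifies the result with the candidate of `inst B b`.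
    obtain ⟨v, hv, hv'⟩ := exists_admissible (CoC.cls (clsEnv Γ) A) (interp (clsEnv Γ) r b)
    have hmem := mem_piCand.1 (iha r t h) _ (ihb r t h) v hv
    obtain ⟨c, hB, hc⟩ : ∃ c, CoC.cls (clsEnv (A :: Γ)) B = some c ∧ c.skel = .star := by
      obtain ⟨h, -⟩ | ⟨u, hAB, -⟩ | hAB := ha.cls
      · cases h
      all_goals
        simp only [CoC.cls] at hAB
        obtain ⟨s, t, hA, hB, -⟩ | ⟨t, hA, hB, -⟩ | ⟨s, hA, hB, -⟩ | ⟨hA, hB, -⟩ :=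
          Cls.pi_eq_some hAB <;> exact ⟨_, hB, rfl⟩
    have := interp_inst (r := r) hb.cls.of_dom hv' hB
    rw [hc] at this
    rw [interpCand, this]
    exact hmem
  · intro Γ A B a s ha hB h iha _ r t ht
    obtain ⟨d, hd, hd'⟩ := hB.cls.isDom.exists_cls
    -- A type in a judgement lacks a class only if it is `□`, which is not convertible to the
    -- classified `B`.
    have hA : ∃ c, CoC.cls (clsEnv Γ) A = some c := by
      obtain ⟨h', -⟩ | ⟨u, hA, -⟩ | hA := ha.cls
      · exact absurd h' (h.ne_box hd)
      · exact ⟨_, hA⟩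
      · exact ⟨_, hA⟩
    obtain ⟨c, hc⟩ := hA
    have := h.interp_eq (r := r) hc hd
    rw [h.cls_eq hc hd, hd'] at this
    rw [interpCand, ← this]
    exact iha r t ht

end CoC

theorem mainTheorem1 (Γ : CoC.Ctx CoC.CCSort) (a A : CoC.Exp CoC.CCSort)
    (h : CoC.Typing CoC.CC Γ a A) : a ∈ CoC.SN := by
  -- Any values would do here: variables belong to every candidate.
  have := h.realizes default CoC.Exp.var fun x A _ => CoC.Cand.var_mem _ x
  rw [CoC.Exp.subst_var] at this
  exact (CoC.Cand.norm _ _ this).mem_SN
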